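/- Let $d\ge 1$ and $1<p<\infty$, and put $p'=p/(p-1)$. A cube is a non-degenerate cube in $\mathbb{R}^d$ with sides parallel to the axes. For $0\le\alpha<d$ and a locally integrable $\varphi:\mathbb{R}^d\to\mathbb{R}$ let $$\mathcal{M}^\alpha\varphi(x)=\sup\Big\{|Q|^{\frac{\alpha}{d}-1}\int_Q|\varphi(u)|\,du:\ Q\text{ is a cube containing }x\Big\}.$$ A weight is a locally integrable, (a.e.) positive function $w$ on $\mathbb{R}^d$. For $1<r<\infty$, $w$ is an $A_r$ weight if $$[w]_{A_r}=\sup_Q\Big(\frac1{|Q|}\int_Q w\Big)\Big(\frac1{|Q|}\int_Q w^{-1/(r-1)}\Big)^{r-1}<\infty,$$ where the supremum is over all cubes $Q$. Write $\|f\|_{L^p(v)}=\big(\int_{\mathbb{R}^d}|f|^p v\,du\big)^{1/p}\in[0,\infty]$. (i) Let $0\le\alpha<d$ and let $0<q<\infty$ satisfy $\frac1q=\frac1p-\frac{\alpha}{d}$. There is a finite constant $C_{p,\alpha,d}$, depending only on $p$, $\alpha$ and $d$, such that for every $A_{q/p'+1}$ weight $w$ and every locally integrable $\varphi$ on $\mathbb{R}^d$,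 $$\|\mathcal{M}^\alpha\varphi\|_{L^q(w)}\le C_{p,\alpha,d}\,[w]_{A_{q/p'+1}}^{(1-\alpha/d)p'/q}\,\|\varphi\|_{L^p(w^{p/q})}.$$ (ii) In particular (the case $\alpha=0$, $q=p$), there is a finite constant $C_{p,d}$, depending only on $p$ and $d$, such that for every $A_p$ weight $w$ and every locally integrable $\varphi$ on $\mathbb{R}^d$, $$\|\mathcal{M}^0\varphi\|_{L^p(w)}\le C_{p,d}\,[w]_{A_p}^{1/(p-1)}\,\|\varphi\|_{L^p(w)}.$$ -/

import Mathlib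

open MeasureTheory Set
open scoped ENNReal NNReal

noncomputable section

/-- `Q` is a (closed, non-degenerate) cube in `ℝ^d` with sides parallel to the axes: the product of
the intervals `[a i, a i + l]` with one common side length `l > 0`. -/
def IsCube {d : ℕ} (Q : Set (Fin d → ℝ)) : Prop :=
  ∃ (a : Fin d → ℝ) (l : ℝ), 0 < l ∧ Q = Icc a (fun i => a i + l)

/-- The fractional maximal operator of order `α`, as a function with values in `[0, ∞]`:
the supremum of `|Q|^(α/d - 1) ∫_Q |φ|` over all cubes `Q` containing `x`. -/
def fracMaximal {d : ℕ} (α : ℝ) (φ : (Fin d → ℝ) → ℝ) (x : Fin d → ℝ) : ℝ≥0∞ :=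
  ⨆ (Q : Set (Fin d → ℝ)) (_ : IsCube Q) (_ : x ∈ Q),
    volume Q ^ (α / d - 1) * ∫⁻ u in Q, ‖φ u‖ₑ

/-- A weight: a locally integrable, (almost everywhere) positive function on `ℝ^d`. -/
def IsWeight {d : ℕ} (w : (Fin d → ℝ) → ℝ) : Prop :=
  LocallyIntegrable w volume ∧ ∀ᵐ x, 0 < w x

/-- The `A_r` characteristic `[w]_{A_r}` (for `1 < r < ∞`), with values in `[0, ∞]`: the supremum
over all cubes `Q` of the average of `w` over `Q` times the `(r - 1)`-th power of the average of
`w^(-1/(r-1))` over `Q`. -/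
def ApChar {d : ℕ} (r : ℝ) (w : (Fin d → ℝ) → ℝ) : ℝ≥0∞ :=
  ⨆ (Q : Set (Fin d → ℝ)) (_ : IsCube Q),
    ((volume Q)⁻¹ * ∫⁻ x in Q, ENNReal.ofReal (w x)) *
      ((volume Q)⁻¹ * ∫⁻ x in Q, ENNReal.ofReal (w x) ^ (-1 / (r - 1))) ^ (r - 1)

/-- `w` is an `A_r` weight. -/
def IsApWeight {d : ℕ} (r : ℝ) (w : (Fin d → ℝ) → ℝ) : Prop :=
  IsWeight w ∧ ApChar r w < ∞

/-- The norm `(∫ f^p v)^(1/p)` in the weighted space `L^p(v)` of a function `f` with values in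
`[0, ∞]`. The value is `∞` if the integral diverges. -/
def weightedNorm {d : ℕ} (p : ℝ) (v : (Fin d → ℝ) → ℝ) (f : (Fin d → ℝ) → ℝ≥0∞) : ℝ≥0∞ :=
  (∫⁻ x, f x ^ p * ENNReal.ofReal (v x)) ^ (1 / p)

end

/-!
Every cube lies in a comparable cube of one of `2 ^ d` shifted triadic grids, so it is enough to
bound the maximal operator of a nested family of sets. Following Lerner, the `A_r` condition bounds
its `q`-th power pointwise by `[w]_{A_r} ^ r'` times an iteration of two maximal operators of the
same family, a fractional one with respect to the measure `σ = w ^ (-1 / (r - 1)) dx` and an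
ordinary one with respect to `w dx`. Over a nested family a maximal operator taken with respect to
any measure is bounded on the Lebesgue spaces of that same measure, with a constant not depending
on the measure, so neither operator contributes a further power of `[w]_{A_r}`.
-/

section LayerCake

variable {X : Type*} [MeasurableSpace X] {μ : Measure X} {p : ℝ}

theorem setLIntegral_Ioi_zero_ofReal_rpow (s : ℝ) :
    ∫⁻ t in Ioi (0 : ℝ), ENNReal.ofReal (t ^ s) = ∞ := by
  by_contra h
  have hnonneg : 0 ≤ᵐ[volume.restrict (Ioi 0)] fun t : ℝ => t ^ s := by
    filter_upwards [ae_restrict_mem measurableSet_Ioi] with t ht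
    exact Real.rpow_nonneg (le_of_lt ht) s
  have hmeas : Measurable fun t : ℝ => t ^ s := by fun_prop
  exact not_integrableOn_Ioi_rpow s
    ⟨hmeas.aestronglyMeasurable, (hasFiniteIntegral_iff_ofReal hnonneg).2 (lt_top_iff_ne_top.2 h)⟩

theorem lintegral_rpow_eq_lintegral_meas_ofReal_lt_mul {f : X → ℝ≥0∞} (hf : AEMeasurable f μ)
    (hp : 0 < p) :
    ∫⁻ x, f x ^ p ∂μ = ENNReal.ofReal p *
      ∫⁻ t in Ioi (0 : ℝ), μ {x | ENNReal.ofReal t < f x} * ENNReal.ofReal (t ^ (p - 1)) := by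
  by_cases hfin : ∀ᵐ x ∂μ, f x ≠ ∞
  · have hreal := lintegral_rpow_eq_lintegral_meas_lt_mul μ (f := fun x => (f x).toReal)
      (.of_forall fun _ => ENNReal.toReal_nonneg) hf.ennreal_toReal hp
    convert hreal using 1
    · refine lintegral_congr_ae ?_
      filter_upwards [hfin] with x hx
      rw [← ENNReal.ofReal_rpow_of_nonneg ENNReal.toReal_nonneg hp.le, ENNReal.ofReal_toReal hx]
    · congr 1
      refine setLIntegral_congr_fun measurableSet_Ioi fun t ht => ?_
      congr 1
      refine measure_congr (Filter.eventuallyEq_set.2 ?_)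
      filter_upwards [hfin] with x hx using ENNReal.ofReal_lt_iff_lt_toReal (le_of_lt ht) hx
  · have hpos : μ {x | f x = ∞} ≠ 0 := fun h => hfin (by simpa [ae_iff] using h)
    have hleft : ∫⁻ x, f x ^ p ∂μ = ∞ :=
      lintegral_eq_top_of_measure_eq_top_ne_zero (hf.pow_const p)
        (by simpa only [ENNReal.rpow_eq_top_iff_of_pos hp] using hpos)
    have hright : ∫⁻ t in Ioi (0 : ℝ),
        μ {x | ENNReal.ofReal t < f x} * ENNReal.ofReal (t ^ (p - 1)) = ∞ := by
      refine top_le_iff.1 ?_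
      calc ∞ = μ {x | f x = ∞} * ∫⁻ t in Ioi (0 : ℝ), ENNReal.ofReal (t ^ (p - 1)) := by
            rw [setLIntegral_Ioi_zero_ofReal_rpow, ENNReal.mul_top hpos]
        _ ≤ ∫⁻ t in Ioi (0 : ℝ), μ {x | f x = ∞} * ENNReal.ofReal (t ^ (p - 1)) :=
            lintegral_const_mul_le _ _
        _ ≤ _ := by
            gcongr with t x
            rintro (hx : f x = ∞)
            exact hx ▸ ENNReal.ofReal_lt_top
    rw [hleft, hright, ENNReal.mul_top (by simpa using hp)]

theorem lintegral_mul_rpow_eq_lintegral_withDensity_ofReal_lt_mul {f g : X → ℝ≥0∞}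
    (hf : AEMeasurable f μ) (hg : AEMeasurable g μ) (hp : 0 < p) :
    ∫⁻ x, f x * g x ^ p ∂μ = ENNReal.ofReal p * ∫⁻ t in Ioi (0 : ℝ),
      μ.withDensity f {x | ENNReal.ofReal t < g x} * ENNReal.ofReal (t ^ (p - 1)) := by
  rw [← lintegral_rpow_eq_lintegral_meas_ofReal_lt_mul
    (hg.mono_ac (withDensity_absolutelyContinuous μ f)) hp,
    lintegral_withDensity_eq_lintegral_mul₀ hf (hg.pow_const _)]
  rfl

theorem mul_ofReal_rpow_le_mul_ofReal_rpow_sub_one {t : ℝ} (ht : 0 < t) {m b : ℝ≥0∞}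
    (h : ENNReal.ofReal t * m ≤ b) (s : ℝ) :
    m * ENNReal.ofReal (t ^ s) ≤ b * ENNReal.ofReal (t ^ (s - 1)) := by
  calc m * ENNReal.ofReal (t ^ s) = ENNReal.ofReal t * m * ENNReal.ofReal (t ^ (s - 1)) := by
        rw [mul_comm (ENNReal.ofReal t), mul_assoc, ← ENNReal.ofReal_mul ht.le,
          Real.rpow_sub_one ht.ne', mul_div_cancel₀ _ ht.ne']
    _ ≤ b * ENNReal.ofReal (t ^ (s - 1)) := by gcongr

theorem mul_mul_rpow_sub_one (a c : ℝ≥0∞) (hp : 1 ≤ p) :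
    a * (c * a) ^ (p - 1) = c ^ (p - 1) * a ^ p := by
  have hp1 : 0 ≤ p - 1 := sub_nonneg.2 hp
  rw [ENNReal.mul_rpow_of_nonneg _ _ hp1, mul_left_comm]
  nth_rewrite 1 [← ENNReal.rpow_one a]
  rw [← ENNReal.rpow_add_of_nonneg _ _ zero_le_one hp1, add_sub_cancel]

theorem lintegral_rpow_le_of_ofReal_mul_meas_lt_le {F f : X → ℝ≥0∞} {A c : ℝ≥0}
    (hF : AEMeasurable F μ) (hf : AEMeasurable f μ) (hp : 1 < p)
    (h : ∀ t : ℝ, 0 < t → ENNReal.ofReal t * μ {x | ENNReal.ofReal t < F x} ≤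
      A * ∫⁻ x in {x | ENNReal.ofReal t < c * f x}, f x ∂μ) :
    ∫⁻ x, F x ^ p ∂μ ≤ ENNReal.ofReal (p / (p - 1)) * A * c ^ (p - 1) * ∫⁻ x, f x ^ p ∂μ := by
  have hp1 : 0 < p - 1 := sub_pos.2 hp
  have hlevel (t : ℝ) (ht : t ∈ Ioi (0 : ℝ)) :
      μ {x | ENNReal.ofReal t < F x} * ENNReal.ofReal (t ^ (p - 1)) ≤
        A * (μ.withDensity f {x | ENNReal.ofReal t < c * f x} *
          ENNReal.ofReal (t ^ (p - 1 - 1))) := by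
    rw [← mul_assoc]
    refine mul_ofReal_rpow_le_mul_ofReal_rpow_sub_one ht ((h t ht).trans ?_) _
    gcongr
    exact withDensity_apply_le f _
  calc ∫⁻ x, F x ^ p ∂μ
      = ENNReal.ofReal p * ∫⁻ t in Ioi (0 : ℝ),
          μ {x | ENNReal.ofReal t < F x} * ENNReal.ofReal (t ^ (p - 1)) :=
        lintegral_rpow_eq_lintegral_meas_ofReal_lt_mul hF (by linarith)
    _ ≤ ENNReal.ofReal p * (A * ∫⁻ t in Ioi (0 : ℝ),
          μ.withDensity f {x | ENNReal.ofReal t < c * f x} *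
            ENNReal.ofReal (t ^ (p - 1 - 1))) := by
        rw [← lintegral_const_mul' _ _ ENNReal.coe_ne_top]
        gcongr ENNReal.ofReal p * ?_
        exact setLIntegral_mono' measurableSet_Ioi hlevel
    _ = ENNReal.ofReal (p / (p - 1)) * A * ∫⁻ x, f x * (c * f x) ^ (p - 1) ∂μ := by
        rw [lintegral_mul_rpow_eq_lintegral_withDensity_ofReal_lt_mul hf (hf.const_mul _) hp1]
        nth_rewrite 1 [← div_mul_cancel₀ p hp1.ne']
        rw [ENNReal.ofReal_mul (by positivity)]
        ring
    _ = _ := by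
        simp_rw [mul_mul_rpow_sub_one _ _ hp.le]
        rw [lintegral_const_mul'' _ (hf.pow_const p), mul_assoc _ _ (∫⁻ x, f x ^ p ∂μ)]

end LayerCake

section NestedFamily

variable {X ι : Type*} {P : ι → Set X}

/-- Any two members of the family are comparable or disjoint, as for the cubes of a dyadic grid. -/
def IsNestedFamily (P : ι → Set X) : Prop :=
  ∀ i j, P i ⊆ P j ∨ P j ⊆ P i ∨ Disjoint (P i) (P j)

theorem IsNestedFamily.comp {κ : Type*} (hP : IsNestedFamily P) (e : κ → ι) :
    IsNestedFamily (P ∘ e) :=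
  fun i j => hP (e i) (e j)

/-- The maximal function of `f` with respect to the measure `μ`, where the supremum runs over the
members of a family of sets. The exponent `θ = 1` gives the supremum of the averages of `f`, smaller
exponents give fractional maximal functions. -/
noncomputable def familyMaximal [MeasurableSpace X] (P : ι → Set X) (μ : Measure X) (θ : ℝ)
    (f : X → ℝ≥0∞) (x : X) : ℝ≥0∞ :=
  ⨆ (i) (_ : x ∈ P i), μ (P i) ^ (-θ) * ∫⁻ y in P i, f y ∂μ

variable [MeasurableSpace X] {μ ν : Measure X} {θ q : ℝ} {f : X → ℝ≥0∞}

theorem le_familyMaximal {i : ι} {x : X} (hx : x ∈ P i) :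
    μ (P i) ^ (-θ) * ∫⁻ y in P i, f y ∂μ ≤ familyMaximal P μ θ f x :=
  le_iSup₂ (f := fun i (_ : x ∈ P i) => μ (P i) ^ (-θ) * ∫⁻ y in P i, f y ∂μ) i hx

theorem familyMaximal_rpow_le_iff (hq : 0 < q) {x : X} {b : ℝ≥0∞} :
    familyMaximal P μ θ f x ^ q ≤ b ↔
      ∀ i, x ∈ P i → (μ (P i) ^ (-θ) * ∫⁻ y in P i, f y ∂μ) ^ q ≤ b := by
  simp only [← ENNReal.le_rpow_inv_iff hq, familyMaximal, iSup_le_iff]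

theorem setOf_lt_familyMaximal (t : ℝ≥0∞) :
    {x | t < familyMaximal P μ θ f x} =
      ⋃ i : {i // t < μ (P i) ^ (-θ) * ∫⁻ y in P i, f y ∂μ}, P i := by
  ext x
  simp only [familyMaximal, mem_ofPred_eq, lt_iSup_iff, mem_iUnion, Subtype.exists, exists_prop,
    and_comm]

theorem measurable_familyMaximal [Countable ι] (hPm : ∀ i, MeasurableSet (P i)) :
    Measurable (familyMaximal P μ θ f) :=
  measurable_of_Ioi fun t => by
    change MeasurableSet {x | t < familyMaximal P μ θ f x}
    rw [setOf_lt_familyMaximal]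
    exact .iUnion fun i => hPm i

theorem IsNestedFamily.measure_biUnion_finset_le (hP : IsNestedFamily P)
    (hPm : ∀ i, MeasurableSet (P i)) (h : ∀ i, μ (P i) ≤ ν (P i)) (s : Finset ι) :
    μ (⋃ i ∈ s, P i) ≤ ν (⋃ i ∈ s, P i) := by
  classical
  set T := {A ∈ s.image P | Maximal (· ∈ s.image P) A}
  have hmem {A} (hA : A ∈ T) : ∃ i ∈ s, P i = A :=
    Finset.mem_image.1 (Finset.mem_filter.1 hA).1
  have hcover : ⋃ i ∈ s, P i = ⋃ A ∈ T, A := by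
    refine subset_antisymm (iUnion₂_subset fun i hi => ?_) (iUnion₂_subset fun A hA => ?_)
    · obtain ⟨A, hiA, hA⟩ := (s.image P).exists_le_maximal (Finset.mem_image_of_mem P hi)
      exact hiA.trans (subset_biUnion_of_mem (u := id) (Finset.mem_filter.2 ⟨hA.1, hA⟩))
    · obtain ⟨i, hi, rfl⟩ := hmem hA
      exact subset_biUnion_of_mem (u := P) hi
  have hdisj : (T : Set (Set X)).PairwiseDisjoint id := by
    intro A hA B hB hAB
    obtain ⟨i, -, rfl⟩ := hmem hA
    obtain ⟨j, -, rfl⟩ := hmem hB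
    have hmaxA := (Finset.mem_filter.1 hA).2
    have hmaxB := (Finset.mem_filter.1 hB).2
    rcases hP i j with hij | hji | hij
    · exact absurd (hmaxA.eq_of_subset hmaxB.1 hij) hAB
    · exact absurd (hmaxB.eq_of_subset hmaxA.1 hji) hAB.symm
    · exact hij
  have hmeas {A} (hA : A ∈ T) : MeasurableSet A := by
    obtain ⟨i, -, rfl⟩ := hmem hA
    exact hPm i
  rw [hcover]
  calc μ (⋃ A ∈ T, A) ≤ ∑ A ∈ T, μ A := MeasureTheory.measure_biUnion_finset_le T id
    _ ≤ ∑ A ∈ T, ν A := Finset.sum_le_sum fun A hA => by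
        obtain ⟨i, -, rfl⟩ := hmem hA
        exact h i
    _ = ν (⋃ A ∈ T, A) := (measure_biUnion_finset hdisj fun A hA => hmeas hA).symm

theorem IsNestedFamily.measure_iUnion_le [Countable ι] (hP : IsNestedFamily P)
    (hPm : ∀ i, MeasurableSet (P i)) (h : ∀ i, μ (P i) ≤ ν (P i)) :
    μ (⋃ i, P i) ≤ ν (⋃ i, P i) := by
  have hdir : Directed (· ⊆ ·) fun s : Finset ι => ⋃ i ∈ s, P i :=
    directed_of_isDirected_le fun _ _ hst => biUnion_subset_biUnion_left hst
  rw [iUnion_eq_iUnion_finset, hdir.measure_iUnion, hdir.measure_iUnion]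
  exact iSup_mono fun s => hP.measure_biUnion_finset_le hPm h s

theorem setLIntegral_le_setLIntegral_indicator_add (t : ℝ≥0∞) (A : Set X) :
    ∫⁻ x in A, f x ∂μ ≤ ∫⁻ x in A, {x | t < f x}.indicator f x ∂μ + t * μ A := by
  rw [← setLIntegral_const, ← lintegral_add_right _ measurable_const]
  gcongr with x
  by_cases hx : t < f x
  · exact (indicator_of_mem (s := {x | t < f x}) hx f).ge.trans le_self_add
  · exact (not_lt.1 hx).trans le_add_self

theorem IsNestedFamily.mul_measure_lt_familyMaximal_le [Countable ι] (hP : IsNestedFamily P)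
    (hPm : ∀ i, MeasurableSet (P i)) (t : ℝ≥0∞) :
    t * μ {x | t < familyMaximal P μ 1 f x} ≤ 2 * ∫⁻ x in {x | t < 2 * f x}, f x ∂μ := by
  have hhalf : {x | t < 2 * f x} = {x | t / 2 < f x} := by
    ext x
    exact (ENNReal.div_lt_iff (.inl two_ne_zero) (.inl ENNReal.ofNat_ne_top)).trans
      (by rw [mul_comm]; rfl) |>.symm
  set E := {x | t / 2 < f x}
  set ρ := μ.withDensity (E.indicator f)
  set I := {i // t < μ (P i) ^ (-(1 : ℝ)) * ∫⁻ y in P i, f y ∂μ}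
  have hmember (i : I) : ((t / 2) • μ) (P i) ≤ ρ (P i) := by
    obtain ⟨i, hi⟩ := i
    rw [ENNReal.rpow_neg_one, mul_comm, ← div_eq_mul_inv] at hi
    have hfin : t / 2 * μ (P i) ≠ ∞ := by
      refine ENNReal.mul_ne_top (ENNReal.div_ne_top hi.ne_top two_ne_zero) fun hμ => ?_
      rw [hμ, ENNReal.div_top] at hi
      exact not_lt_bot hi
    refine (ENNReal.add_le_add_iff_right hfin).1 ?_
    calc (t / 2) * μ (P i) + t / 2 * μ (P i) = t * μ (P i) := by
          rw [← add_mul, ENNReal.add_halves]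
      _ ≤ ∫⁻ x in P i, f x ∂μ := ENNReal.mul_le_of_le_div hi.le
      _ ≤ ∫⁻ x in P i, E.indicator f x ∂μ + t / 2 * μ (P i) :=
          setLIntegral_le_setLIntegral_indicator_add _ _
      _ = ρ (P i) + t / 2 * μ (P i) := by rw [withDensity_apply _ (hPm i)]
  rw [hhalf, setOf_lt_familyMaximal]
  calc t * μ (⋃ i : I, P i) = 2 * ((t / 2) • μ) (⋃ i : I, P i) := by
        rw [Measure.smul_apply, smul_eq_mul, ← mul_assoc,
          ENNReal.mul_div_cancel two_ne_zero ENNReal.ofNat_ne_top]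
    _ ≤ 2 * ρ (⋃ i : I, P i) := by
        gcongr 2 * ?_
        exact (hP.comp ((↑) : I → ι)).measure_iUnion_le (fun i => hPm i) hmember
    _ ≤ 2 * ∫⁻ x in E, f x ∂μ := by
        gcongr
        rw [withDensity_apply _ (.iUnion fun i : I => hPm i)]
        exact (setLIntegral_le_lintegral _ _).trans (lintegral_indicator_le _ _)

end NestedFamily

section StrongType

variable {X ι : Type*} [MeasurableSpace X] {P : ι → Set X} {μ : Measure X} {p q : ℝ}
  {f : X → ℝ≥0∞}

/-- The constant in the strong type `(p, p)` inequality for the maximal operator of a nested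
family. -/
noncomputable def maximalConst (p : ℝ) : ℝ≥0∞ :=
  ENNReal.ofReal (p / (p - 1)) * 2 * 2 ^ (p - 1)

theorem maximalConst_ne_top (hp : 1 ≤ p) : maximalConst p ≠ ∞ := by
  have h : (2 : ℝ≥0∞) ^ (p - 1) ≠ ∞ := ENNReal.rpow_ne_top_of_nonneg (by linarith) (by simp)
  unfold maximalConst
  finiteness

theorem IsNestedFamily.lintegral_familyMaximal_rpow_le [Countable ι] (hP : IsNestedFamily P)
    (hPm : ∀ i, MeasurableSet (P i)) (hf : AEMeasurable f μ) (hp : 1 < p) :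
    ∫⁻ x, familyMaximal P μ 1 f x ^ p ∂μ ≤ maximalConst p * ∫⁻ x, f x ^ p ∂μ :=
  lintegral_rpow_le_of_ofReal_mul_meas_lt_le (A := 2) (c := 2)
    (measurable_familyMaximal hPm).aemeasurable hf hp
    fun _ _ => hP.mul_measure_lt_familyMaximal_le hPm _

theorem setLIntegral_le_rpow_mul_measure_rpow (hf : AEMeasurable f μ) (hp : 1 ≤ p) (A : Set X) :
    ∫⁻ x in A, f x ∂μ ≤ (∫⁻ x, f x ^ p ∂μ) ^ (1 / p) * μ A ^ (1 - 1 / p) := by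
  have h := eLpNorm'_le_eLpNorm'_mul_rpow_measure_univ zero_lt_one hp
    hf.restrict.aestronglyMeasurable (μ := μ.restrict A)
  simp only [eLpNorm'_eq_lintegral_enorm, enorm_eq_self, ENNReal.rpow_one, div_one,
    Measure.restrict_apply_univ] at h
  refine h.trans ?_
  gcongr
  exact Measure.restrict_le_self

theorem mul_rpow_le_mul_rpow_of_le_rpow_mul_rpow {m J I : ℝ≥0∞} (hm : m ≠ 0) (hm' : m ≠ ∞)
    (hp : 0 < p) (hpq : p ≤ q) (hJ : J ≤ I ^ (1 / p) * m ^ (1 - 1 / p)) :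
    (m ^ (-(1 / q + 1 - 1 / p)) * J) ^ q ≤ (m ^ (-1 : ℝ) * J) ^ p * I ^ (q / p - 1) := by
  have hq : 0 < q := hp.trans_le hpq
  have hqp : 0 ≤ q - p := sub_nonneg.2 hpq
  have hJq : J ^ q ≤ J ^ p * (I ^ (q / p - 1) * m ^ ((1 - 1 / p) * (q - p))) := by
    calc J ^ q = J ^ p * J ^ (q - p) := by
          rw [← ENNReal.rpow_add_of_nonneg _ _ hp.le hqp, add_sub_cancel]
      _ ≤ J ^ p * (I ^ (1 / p) * m ^ (1 - 1 / p)) ^ (q - p) := by gcongr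
      _ = J ^ p * (I ^ (q / p - 1) * m ^ ((1 - 1 / p) * (q - p))) := by
          rw [ENNReal.mul_rpow_of_nonneg _ _ hqp, ← ENNReal.rpow_mul, ← ENNReal.rpow_mul,
            show 1 / p * (q - p) = q / p - 1 by field_simp]
  have hexp : -(1 / q + 1 - 1 / p) * q + (1 - 1 / p) * (q - p) = -1 * p := by
    field_simp
    ring
  calc (m ^ (-(1 / q + 1 - 1 / p)) * J) ^ q
      = m ^ (-(1 / q + 1 - 1 / p) * q) * J ^ q := by
        rw [ENNReal.mul_rpow_of_nonneg _ _ hq.le, ← ENNReal.rpow_mul]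
    _ ≤ m ^ (-(1 / q + 1 - 1 / p) * q) *
          (J ^ p * (I ^ (q / p - 1) * m ^ ((1 - 1 / p) * (q - p)))) := by gcongr
    _ = m ^ (-1 * p) * J ^ p * I ^ (q / p - 1) := by
        rw [← hexp, ENNReal.rpow_add _ _ hm hm']
        ring
    _ = (m ^ (-1 : ℝ) * J) ^ p * I ^ (q / p - 1) := by
        rw [ENNReal.mul_rpow_of_nonneg _ _ hp.le, ← ENNReal.rpow_mul]

theorem familyMaximal_rpow_le (hf : AEMeasurable f μ) (hp : 1 ≤ p) (hpq : p ≤ q) (x : X) :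
    familyMaximal P μ (1 / q + 1 - 1 / p) f x ^ q ≤
      familyMaximal P μ 1 f x ^ p * (∫⁻ y, f y ^ p ∂μ) ^ (q / p - 1) := by
  have hp0 : 0 < p := by linarith
  have hq : 0 < q := hp0.trans_le hpq
  refine (familyMaximal_rpow_le_iff hq).2 fun i hx => ?_
  by_cases hm : μ (P i) = 0
  · simp [setLIntegral_measure_zero _ _ hm, hq]
  by_cases hm' : μ (P i) = ∞
  · have hθ : 0 < 1 / q + 1 - 1 / p := by
      have : 0 < 1 / q := by positivity
      have : 1 / p ≤ 1 := (div_le_one hp0).2 hp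
      linarith
    rw [hm', ENNReal.rpow_neg, ENNReal.top_rpow_of_pos hθ, ENNReal.inv_top, zero_mul,
      ENNReal.zero_rpow_of_pos hq]
    exact zero_le
  calc (μ (P i) ^ (-(1 / q + 1 - 1 / p)) * ∫⁻ y in P i, f y ∂μ) ^ q
      ≤ (μ (P i) ^ (-1 : ℝ) * ∫⁻ y in P i, f y ∂μ) ^ p * (∫⁻ y, f y ^ p ∂μ) ^ (q / p - 1) :=
        mul_rpow_le_mul_rpow_of_le_rpow_mul_rpow hm hm' hp0 hpq
          (setLIntegral_le_rpow_mul_measure_rpow hf hp _)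
    _ ≤ _ := by
        gcongr
        exact le_familyMaximal hx

theorem IsNestedFamily.lintegral_fractional_familyMaximal_rpow_le [Countable ι]
    (hP : IsNestedFamily P) (hPm : ∀ i, MeasurableSet (P i)) (hf : AEMeasurable f μ)
    (hp : 1 < p) (hpq : p ≤ q) :
    ∫⁻ x, familyMaximal P μ (1 / q + 1 - 1 / p) f x ^ q ∂μ ≤
      maximalConst p * (∫⁻ x, f x ^ p ∂μ) ^ (q / p) := by
  have hp0 : 0 < p := by linarith
  have hqp : 0 ≤ q / p - 1 := sub_nonneg.2 ((one_le_div hp0).2 hpq)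
  set I := ∫⁻ x, f x ^ p ∂μ
  calc ∫⁻ x, familyMaximal P μ (1 / q + 1 - 1 / p) f x ^ q ∂μ
      ≤ ∫⁻ x, familyMaximal P μ 1 f x ^ p * I ^ (q / p - 1) ∂μ :=
        lintegral_mono fun x => familyMaximal_rpow_le hf hp.le hpq x
    _ = (∫⁻ x, familyMaximal P μ 1 f x ^ p ∂μ) * I ^ (q / p - 1) :=
        lintegral_mul_const _ ((measurable_familyMaximal hPm).pow_const p)
    _ ≤ maximalConst p * I * I ^ (q / p - 1) := by
        gcongr
        exact hP.lintegral_familyMaximal_rpow_le hPm hf hp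
    _ = maximalConst p * I ^ (q / p) := by
        nth_rewrite 1 [mul_assoc, ← ENNReal.rpow_one I]
        rw [← ENNReal.rpow_add_of_nonneg _ _ zero_le_one hqp, add_sub_cancel]

end StrongType

section Density

variable {X : Type*} [MeasurableSpace X] {ν : Measure X} {V : X → ℝ≥0∞} {p : ℝ}

theorem lintegral_div_rpow_withDensity (hV : AEMeasurable V ν) (hV0 : ∀ᵐ x ∂ν, V x ≠ 0)
    (hVt : ∀ᵐ x ∂ν, V x ≠ ∞) (hp : 0 ≤ p) (f : X → ℝ≥0∞) :
    ∫⁻ x, (f x / V x) ^ p ∂(ν.withDensity V) = ∫⁻ x, f x ^ p * V x ^ (1 - p) ∂ν := by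
  rw [lintegral_withDensity_eq_lintegral_mul_non_measurable₀ _ hV
    (hVt.mono fun _ => lt_top_iff_ne_top.2)]
  refine lintegral_congr_ae ?_
  filter_upwards [hV0, hVt] with x h0 ht
  rw [Pi.mul_apply, ENNReal.div_rpow_of_nonneg _ _ hp, ENNReal.rpow_sub _ _ h0 ht,
    ENNReal.rpow_one, div_eq_mul_inv, div_eq_mul_inv, mul_left_comm]

theorem setLIntegral_div_withDensity (hV : AEMeasurable V ν) (hV0 : ∀ᵐ x ∂ν, V x ≠ 0)
    (hVt : ∀ᵐ x ∂ν, V x ≠ ∞) (f : X → ℝ≥0∞) {A : Set X} (hA : MeasurableSet A) :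
    ∫⁻ x in A, f x / V x ∂(ν.withDensity V) = ∫⁻ x in A, f x ∂ν := by
  have h := lintegral_div_rpow_withDensity hV.restrict (ae_restrict_of_ae hV0)
    (ae_restrict_of_ae hVt) zero_le_one f (ν := ν.restrict A)
  simpa only [restrict_withDensity hA, ENNReal.rpow_one, sub_self, ENNReal.rpow_zero, mul_one]
    using h

end Density

section Muckenhoupt

variable {X ι : Type*} [MeasurableSpace X] {P : ι → Set X} {ν ω σ : Measure X}
  {p p' q r r' : ℝ} {f g h : X → ℝ≥0∞}

/-- The Muckenhoupt `A_r` characteristic of the pair of measures `ω`, `σ` relative to the base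
measure `ν`, with averages over the members of a family of sets. The characteristic of a weight `w`
is the case where `ω` has density `w` and `σ` has the dual density `w ^ (-1 / (r - 1))`. -/
noncomputable def familyApChar (P : ι → Set X) (ν ω σ : Measure X) (r : ℝ) : ℝ≥0∞ :=
  ⨆ i, (ν (P i))⁻¹ * ω (P i) * ((ν (P i))⁻¹ * σ (P i)) ^ (r - 1)

theorem muckenhoupt_exponent_div_eq (hp : p.HolderConjugate p') (hq : q ≠ 0)
    (hrq : r = q / p' + 1) : r / q = 1 / q + 1 - 1 / p := by
  have hp' := hp.symm.ne_zero
  calc r / q = 1 / q + p'⁻¹ := by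
        rw [hrq]
        field_simp
        ring
    _ = 1 / q + 1 - 1 / p := by
        rw [← hp.one_sub_inv]
        ring

theorem one_sub_mul_one_sub_eq_div (hp : p.HolderConjugate p') (hr : r.HolderConjugate r')
    (hq : q ≠ 0) (hrq : r = q / p' + 1) : (1 - r') * (1 - p) = p / q := by
  have hp' := hp.symm.ne_zero
  calc (1 - r') * (1 - p) = (r' - 1) * (p / p') := by
        rw [hp.div_conj_eq_sub_one]
        ring
    _ = (r - 1) * (r' - 1) * (p / q) := by
        rw [hrq]
        field_simp
        ring
    _ = p / q := by linear_combination (p / q) * hr.mul_eq_add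

theorem rpow_neg_mul_rpow_eq_muckenhoupt_mul_rpow {n w s : ℝ≥0∞} (hr : r.HolderConjugate r')
    (hq : 0 < q) (hn : n ≠ 0) (hn' : n ≠ ∞) (hw : w ≠ 0) (hw' : w ≠ ∞) (hs : s ≠ 0)
    (hs' : s ≠ ∞) (J : ℝ≥0∞) :
    (n ^ (-(r / q)) * J) ^ q =
      (n⁻¹ * w * (n⁻¹ * s) ^ (r - 1) * (w⁻¹ * ((s ^ (-(r / q)) * J) ^ (q / r') * n))) ^ r' := by
  have hr' : 0 < r' := hr.symm.pos
  have hexp : (r - 1) * r' = r := by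
    rw [hr.conjugate_eq]
    field_simp [hr.sub_one_pos.ne']
  have hexp' : -(r / q) * q = -r := by field_simp
  calc (n ^ (-(r / q)) * J) ^ q = n ^ (-r) * (s ^ r * s ^ (-r)) * J ^ q := by
        rw [← ENNReal.rpow_add _ _ hs hs', add_neg_cancel, ENNReal.rpow_zero, mul_one,
          ENNReal.mul_rpow_of_nonneg _ _ hq.le, ← ENNReal.rpow_mul, hexp']
    _ = ((n⁻¹ * s) ^ (r - 1) * (s ^ (-(r / q)) * J) ^ (q / r')) ^ r' := by
        rw [ENNReal.mul_rpow_of_nonneg _ _ hr'.le, ← ENNReal.rpow_mul, ← ENNReal.rpow_mul,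
          div_mul_cancel₀ _ hr'.ne', ENNReal.mul_rpow_of_nonneg _ _ hq.le, ← ENNReal.rpow_mul,
          hexp, hexp', ENNReal.mul_rpow_of_nonneg _ _ hr.pos.le, ENNReal.inv_rpow,
          ← ENNReal.rpow_neg]
        ring
    _ = ((n⁻¹ * n) * (w⁻¹ * w) *
          ((n⁻¹ * s) ^ (r - 1) * (s ^ (-(r / q)) * J) ^ (q / r'))) ^ r' := by
        rw [ENNReal.inv_mul_cancel hn hn', ENNReal.inv_mul_cancel hw hw', one_mul, one_mul]
    _ = _ := by
        congr 1
        ring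

theorem measure_ne_top_of_familyApChar_ne_top (hr : 1 < r) (hK : familyApChar P ν ω σ r ≠ ∞)
    {i : ι} (hν : ν (P i) ≠ ∞) (hω : ω (P i) ≠ 0) (hσ : σ (P i) ≠ 0) :
    ω (P i) ≠ ∞ ∧ σ (P i) ≠ ∞ := by
  have hr1 : 0 < r - 1 := by linarith
  have hinv : (ν (P i))⁻¹ ≠ 0 := ENNReal.inv_ne_zero.2 hν
  have hi : (ν (P i))⁻¹ * ω (P i) * ((ν (P i))⁻¹ * σ (P i)) ^ (r - 1) ≠ ∞ :=
    ne_top_of_le_ne_top hK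
      (le_iSup (fun i => (ν (P i))⁻¹ * ω (P i) * ((ν (P i))⁻¹ * σ (P i)) ^ (r - 1)) i)
  refine ⟨fun h => hi ?_, fun h => hi ?_⟩
  · rw [h, ENNReal.mul_top hinv, ENNReal.top_mul]
    simp [ENNReal.rpow_eq_zero_iff, hinv, hσ, hr1.not_gt]
  · rw [h, ENNReal.mul_top hinv, ENNReal.top_rpow_of_pos hr1, ENNReal.mul_top]
    exact mul_ne_zero hinv hω

theorem familyMaximal_rpow_le_familyApChar_mul (hPm : ∀ i, MeasurableSet (P i))
    (hr : r.HolderConjugate r') (hq : 0 < q) (hω : ν ≪ ω) (hσ : ν ≪ σ)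
    (hK : familyApChar P ν ω σ r ≠ ∞)
    (hg : ∀ i, ∫⁻ x in P i, g x ∂σ = ∫⁻ x in P i, f x ∂ν)
    (hh : ∀ i, ∫⁻ x in P i, h x ∂ω =
      ∫⁻ x in P i, familyMaximal P σ (r / q) g x ^ (q / r') ∂ν) (x : X) :
    familyMaximal P ν (r / q) f x ^ q ≤
      familyApChar P ν ω σ r ^ r' * familyMaximal P ω 1 h x ^ r' := by
  have hr' : 0 < r' := hr.symm.pos
  have hrq : 0 < r / q := div_pos hr.pos hq
  refine (familyMaximal_rpow_le_iff hq).2 fun i hx => ?_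
  by_cases hν : ν (P i) = 0
  · simp [setLIntegral_measure_zero _ _ hν, hq]
  by_cases hν' : ν (P i) = ∞
  · rw [hν', ENNReal.rpow_neg, ENNReal.top_rpow_of_pos hrq, ENNReal.inv_top, zero_mul,
      ENNReal.zero_rpow_of_pos hq]
    exact zero_le
  have hωi : ω (P i) ≠ 0 := fun h => hν (hω h)
  have hσi : σ (P i) ≠ 0 := fun h => hν (hσ h)
  obtain ⟨hωi', hσi'⟩ := measure_ne_top_of_familyApChar_ne_top hr.lt hK hν' hωi hσi
  -- The `σ`-maximal function of `g` is bounded below on `P i` by its value on the single set `P i`;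
  -- integrating that bound over `P i` gives a lower bound for the integral of `h`.
  have hlower : (σ (P i) ^ (-(r / q)) * ∫⁻ y in P i, f y ∂ν) ^ (q / r') * ν (P i) ≤
      ∫⁻ y in P i, h y ∂ω := by
    rw [hh, ← hg, ← setLIntegral_const]
    refine setLIntegral_mono' (hPm i) fun y hy => ?_
    gcongr
    exact le_familyMaximal hy
  rw [rpow_neg_mul_rpow_eq_muckenhoupt_mul_rpow hr hq hν hν' hωi hωi' hσi hσi',
    ← ENNReal.mul_rpow_of_nonneg _ _ hr'.le]
  gcongr
  · exact le_iSup (fun i => (ν (P i))⁻¹ * ω (P i) * ((ν (P i))⁻¹ * σ (P i)) ^ (r - 1)) i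
  · calc (ω (P i))⁻¹ * ((σ (P i) ^ (-(r / q)) * ∫⁻ y in P i, f y ∂ν) ^ (q / r') * ν (P i))
        ≤ ω (P i) ^ (-(1 : ℝ)) * ∫⁻ y in P i, h y ∂ω := by
          rw [ENNReal.rpow_neg_one]
          gcongr
      _ ≤ familyMaximal P ω 1 h x := le_familyMaximal hx

theorem ae_rpow_ne_zero {W : X → ℝ≥0∞} (hW0 : ∀ᵐ x ∂ν, W x ≠ 0) (hWt : ∀ᵐ x ∂ν, W x ≠ ∞)
    (s : ℝ) : ∀ᵐ x ∂ν, W x ^ s ≠ 0 := by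
  filter_upwards [hW0, hWt] with x h0 ht
  exact (ENNReal.rpow_pos (pos_iff_ne_zero.2 h0) ht).ne'

theorem ae_rpow_ne_top {W : X → ℝ≥0∞} (hW0 : ∀ᵐ x ∂ν, W x ≠ 0) (hWt : ∀ᵐ x ∂ν, W x ≠ ∞)
    (s : ℝ) : ∀ᵐ x ∂ν, W x ^ s ≠ ∞ := by
  filter_upwards [hW0, hWt] with x h0 ht using ENNReal.rpow_ne_top_of_ne_zero h0 ht

theorem IsNestedFamily.lintegral_familyMaximal_dual_rpow_le [Countable ι]
    (hP : IsNestedFamily P) (hPm : ∀ i, MeasurableSet (P i)) (hp : p.HolderConjugate p')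
    (hr : r.HolderConjugate r') (hpq : p ≤ q) (hrq : r = q / p' + 1) {W : X → ℝ≥0∞}
    (hW : AEMeasurable W ν) (hW0 : ∀ᵐ x ∂ν, W x ≠ 0) (hWt : ∀ᵐ x ∂ν, W x ≠ ∞)
    (hf : AEMeasurable f ν) :
    ∫⁻ x, familyMaximal P (ν.withDensity fun x => W x ^ (1 - r')) (r / q)
        (fun y => f y / W y ^ (1 - r')) x ^ q ∂(ν.withDensity fun x => W x ^ (1 - r')) ≤
      maximalConst p * (∫⁻ x, f x ^ p * W x ^ (p / q) ∂ν) ^ (q / p) := by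
  have hq : q ≠ 0 := (hp.pos.trans_le hpq).ne'
  have hS : AEMeasurable (fun x => W x ^ (1 - r')) ν := hW.pow_const _
  have hnorm := lintegral_div_rpow_withDensity hS (ae_rpow_ne_zero hW0 hWt _)
    (ae_rpow_ne_top hW0 hWt _) hp.nonneg f
  simp only [← ENNReal.rpow_mul, one_sub_mul_one_sub_eq_div hp hr hq hrq] at hnorm
  rw [muckenhoupt_exponent_div_eq hp hq hrq, ← hnorm]
  exact hP.lintegral_fractional_familyMaximal_rpow_le hPm
    ((hf.div hS).mono_ac (withDensity_absolutelyContinuous _ _)) hp.lt hpq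

theorem lintegral_rpow_div_rpow_withDensity (hr' : 0 < r') {W G : X → ℝ≥0∞}
    (hW : AEMeasurable W ν) (hW0 : ∀ᵐ x ∂ν, W x ≠ 0) (hWt : ∀ᵐ x ∂ν, W x ≠ ∞) :
    ∫⁻ x, (G x ^ (q / r') / W x) ^ r' ∂(ν.withDensity W) =
      ∫⁻ x, G x ^ q ∂(ν.withDensity fun x => W x ^ (1 - r')) := by
  rw [lintegral_div_rpow_withDensity hW hW0 hWt hr'.le,
    lintegral_withDensity_eq_lintegral_mul_non_measurable₀ _ (hW.pow_const _)
      ((ae_rpow_ne_top hW0 hWt _).mono fun _ => lt_top_iff_ne_top.2)]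
  refine lintegral_congr fun x => ?_
  rw [← ENNReal.rpow_mul, div_mul_cancel₀ _ hr'.ne', mul_comm]
  rfl

theorem IsNestedFamily.lintegral_familyMaximal_rpow_withDensity_le [Countable ι]
    (hP : IsNestedFamily P) (hPm : ∀ i, MeasurableSet (P i)) (hp : p.HolderConjugate p')
    (hr : r.HolderConjugate r') (hpq : p ≤ q) (hrq : r = q / p' + 1) {W : X → ℝ≥0∞}
    (hW : AEMeasurable W ν) (hW0 : ∀ᵐ x ∂ν, W x ≠ 0) (hWt : ∀ᵐ x ∂ν, W x ≠ ∞)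
    (hf : AEMeasurable f ν) {K : ℝ≥0∞} (hK : K ≠ ∞)
    (hKW : familyApChar P ν (ν.withDensity W) (ν.withDensity fun x => W x ^ (1 - r')) r ≤ K) :
    ∫⁻ x, familyMaximal P ν (r / q) f x ^ q ∂(ν.withDensity W) ≤
      K ^ r' * (maximalConst r' *
        (maximalConst p * (∫⁻ x, f x ^ p * W x ^ (p / q) ∂ν) ^ (q / p))) := by
  have hr' : 0 < r' := hr.symm.pos
  have hS : AEMeasurable (fun x => W x ^ (1 - r')) ν := hW.pow_const _
  have hS0 := ae_rpow_ne_zero hW0 hWt (1 - r')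
  have hSt := ae_rpow_ne_top hW0 hWt (1 - r')
  set ω := ν.withDensity W
  set σ := ν.withDensity fun x => W x ^ (1 - r')
  set G := familyMaximal P σ (r / q) fun x => f x / W x ^ (1 - r')
  set h : X → ℝ≥0∞ := fun x => G x ^ (q / r') / W x
  have hGm : Measurable G := measurable_familyMaximal hPm
  have hMh : Measurable (familyMaximal P ω 1 h) := measurable_familyMaximal hPm
  calc ∫⁻ x, familyMaximal P ν (r / q) f x ^ q ∂ω
      ≤ ∫⁻ x, K ^ r' * familyMaximal P ω 1 h x ^ r' ∂ω := by
        gcongr with x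
        refine (familyMaximal_rpow_le_familyApChar_mul hPm hr (hp.pos.trans_le hpq)
          (withDensity_absolutelyContinuous' hW hW0) (withDensity_absolutelyContinuous' hS hS0)
          (ne_top_of_le_ne_top hK hKW) (fun i => setLIntegral_div_withDensity hS hS0 hSt f (hPm i))
          (fun i => setLIntegral_div_withDensity hW hW0 hWt _ (hPm i)) x).trans ?_
        gcongr
    _ = K ^ r' * ∫⁻ x, familyMaximal P ω 1 h x ^ r' ∂ω :=
        lintegral_const_mul _ (hMh.pow_const _)
    _ ≤ K ^ r' * (maximalConst r' * ∫⁻ x, h x ^ r' ∂ω) := by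
        gcongr
        exact hP.lintegral_familyMaximal_rpow_le hPm
          (((hGm.pow_const _).aemeasurable.div hW).mono_ac (withDensity_absolutelyContinuous ν W))
          hr.symm.lt
    _ = K ^ r' * (maximalConst r' * ∫⁻ x, G x ^ q ∂σ) := by
        rw [lintegral_rpow_div_rpow_withDensity hr' hW hW0 hWt]
    _ ≤ _ := by
        gcongr
        exact hP.lintegral_familyMaximal_dual_rpow_le hPm hp hr hpq hrq hW hW0 hWt hf

end Muckenhoupt

section TriadicGrid

variable {d : ℕ} (n : Fin d → Fin 2)

/-- The index of the cube of side `3 ^ k` containing `x`, in the triadic grid shifted by half a side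
length in the coordinates where `n` is `1`. The side ratio `3` is odd, so that half-side shifts at
consecutive scales differ by whole cubes and the shifted grid is still nested. -/
noncomputable def triadicIndex (k : ℤ) (x : Fin d → ℝ) : Fin d → ℤ :=
  fun i => ⌊x i / 3 ^ k - (n i : ℕ) / 2⌋

/-- The cube with index `a.2` and side length `3 ^ a.1` in the shifted triadic grid `n`. -/
def triadicCube (a : ℤ × (Fin d → ℤ)) : Set (Fin d → ℝ) :=
  {x | triadicIndex n a.1 x = a.2}

theorem triadicIndex_succ (k : ℤ) (x : Fin d → ℝ) (i : Fin d) :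
    triadicIndex n (k + 1) x i = (triadicIndex n k x i - (n i : ℕ)) / 3 := by
  have h := Int.floor_div_natCast (x i / 3 ^ k - (n i : ℕ) / 2 - (n i : ℕ)) 3
  rw [Int.floor_sub_natCast] at h
  rw [triadicIndex, triadicIndex, show (3 : ℤ) = (3 : ℕ) from rfl, ← h,
    zpow_add₀ three_ne_zero, zpow_one]
  congr 1
  push_cast
  field_simp
  ring

variable {n}

theorem triadicIndex_eq_of_le {k l : ℤ} (hkl : k ≤ l) {x y : Fin d → ℝ}
    (h : triadicIndex n k x = triadicIndex n k y) : triadicIndex n l x = triadicIndex n l y := by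
  induction l, hkl using Int.leInduction with
  | base => exact h
  | succ l _ ih =>
    funext i
    rw [triadicIndex_succ, triadicIndex_succ, ih]

theorem triadicCube_subset_or_disjoint {a b : ℤ × (Fin d → ℤ)} (hab : a.1 ≤ b.1) :
    triadicCube n a ⊆ triadicCube n b ∨ Disjoint (triadicCube n a) (triadicCube n b) := by
  refine or_iff_not_imp_right.2 fun h x hx => ?_
  obtain ⟨z, hza, hzb⟩ := not_disjoint_iff.1 h
  exact (triadicIndex_eq_of_le hab (Eq.trans hx (Eq.symm hza))).trans hzb

variable (n)

theorem isNestedFamily_triadicCube : IsNestedFamily (triadicCube n) := fun a b => by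
  rcases le_total a.1 b.1 with hab | hba
  · exact (triadicCube_subset_or_disjoint hab).imp_right .inr
  · exact .inr ((triadicCube_subset_or_disjoint hba).imp_right fun h => h.symm)

theorem triadicCube_eq_pi_Ico (a : ℤ × (Fin d → ℤ)) :
    triadicCube n a = univ.pi fun i => Ico ((3 : ℝ) ^ a.1 * (a.2 i + (n i : ℕ) / 2))
      ((3 : ℝ) ^ a.1 * (a.2 i + (n i : ℕ) / 2) + 3 ^ a.1) := by
  have h3 : (0 : ℝ) < 3 ^ a.1 := by positivity
  ext x
  simp only [triadicCube, mem_ofPred_eq, funext_iff, triadicIndex, mem_univ_pi, mem_Ico]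
  refine forall_congr' fun i => ?_
  rw [Int.floor_eq_iff, le_sub_iff_add_le, sub_lt_iff_lt_add, le_div_iff₀ h3, div_lt_iff₀ h3]
  ring_nf

theorem measurableSet_triadicCube (a : ℤ × (Fin d → ℤ)) : MeasurableSet (triadicCube n a) := by
  rw [triadicCube_eq_pi_Ico]
  exact .univ_pi fun _ => measurableSet_Ico

theorem volume_triadicCube (a : ℤ × (Fin d → ℤ)) :
    volume (triadicCube n a) = ENNReal.ofReal (3 ^ a.1) ^ d := by
  simp [triadicCube_eq_pi_Ico, volume_pi, Measure.pi_pi]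

theorem exists_isCube_ae_eq_triadicCube (a : ℤ × (Fin d → ℤ)) :
    ∃ Q, IsCube Q ∧ triadicCube n a =ᵐ[volume] Q := by
  rw [triadicCube_eq_pi_Ico]
  exact ⟨_, ⟨_, 3 ^ a.1, by positivity, rfl⟩, Measure.univ_pi_Ico_ae_eq_Icc⟩

/-- An interval of length less than `1 / 2` cannot meet both `ℤ` and `ℤ + 1 / 2`. -/
theorem exists_forall_mem_Icc_floor_sub_half_eq (x : ℝ) {l : ℝ} (hl : l < 1 / 2) :
    ∃ m : Fin 2, ∀ y ∈ Icc x (x + l), ⌊y - (m : ℕ) / 2⌋ = ⌊x - (m : ℕ) / 2⌋ := by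
  by_cases h : x + l < ⌊x⌋ + 1
  · refine ⟨0, fun y hy => ?_⟩
    simp only [Fin.val_zero, Nat.cast_zero, zero_div, sub_zero]
    rw [Int.floor_eq_iff]
    exact ⟨(Int.floor_le x).trans hy.1, hy.2.trans_lt h⟩
  · refine ⟨1, fun y hy => ?_⟩
    have hx := Int.lt_floor_add_one x
    have hfloor : ⌊x - 1 / 2⌋ = ⌊x⌋ := by
      rw [Int.floor_eq_iff]
      constructor <;> linarith
    simp only [Fin.val_one, Nat.cast_one]
    rw [hfloor, Int.floor_eq_iff]
    constructor <;> linarith [hy.1, hy.2]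

theorem IsCube.exists_subset_triadicCube {Q : Set (Fin d → ℝ)} (hQ : IsCube Q) :
    ∃ (n : Fin d → Fin 2) (a : ℤ × (Fin d → ℤ)), Q ⊆ triadicCube n a ∧
      volume (triadicCube n a) ≤ 6 ^ d * volume Q := by
  obtain ⟨c, l, hl, rfl⟩ := hQ
  obtain ⟨k, hkl, hlk⟩ := exists_mem_Ico_zpow (show 0 < 2 * l by linarith)
    (show (1 : ℝ) < 3 by norm_num)
  have h3 : (0 : ℝ) < 3 ^ (k + 1) := by positivity
  have hlt : l / 3 ^ (k + 1) < 1 / 2 := by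
    rw [div_lt_iff₀ h3]
    linarith
  have hle : (3 : ℝ) ^ (k + 1) ≤ 6 * l := by
    rw [zpow_add₀ three_ne_zero, zpow_one]
    linarith
  choose n hn using fun i => exists_forall_mem_Icc_floor_sub_half_eq (c i / 3 ^ (k + 1)) hlt
  refine ⟨n, (k + 1, triadicIndex n (k + 1) c), fun x hx => funext fun i => hn i _ ⟨?_, ?_⟩, ?_⟩
  · exact div_le_div_of_nonneg_right (hx.1 i) h3.le
  · rw [← add_div]
    exact div_le_div_of_nonneg_right (hx.2 i) h3.le
  · calc volume (triadicCube n (k + 1, triadicIndex n (k + 1) c))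
        = ENNReal.ofReal (3 ^ (k + 1)) ^ d := volume_triadicCube _ _
      _ ≤ ENNReal.ofReal (6 * l) ^ d := by gcongr
      _ = 6 ^ d * volume (Icc c fun i => c i + l) := by
        rw [ENNReal.ofReal_mul (by norm_num), mul_pow, Real.volume_Icc_pi]
        simp

end TriadicGrid

section FracMaximal

variable {d : ℕ}

theorem rpow_neg_le_mul_rpow_neg {a b c : ℝ≥0∞} {θ : ℝ} (hc : c ≠ 0) (hc' : c ≠ ∞)
    (hθ : 0 ≤ θ) (h : b ≤ c * a) : a ^ (-θ) ≤ c ^ θ * b ^ (-θ) := by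
  calc a ^ (-θ) = c ^ θ * (c * a) ^ (-θ) := by
        rw [ENNReal.mul_rpow_eq_ite, if_neg (by simp [hc, hc']), ← mul_assoc,
          ← ENNReal.rpow_add _ _ hc hc', add_neg_cancel, ENNReal.rpow_zero, one_mul]
    _ ≤ c ^ θ * b ^ (-θ) := by
        rw [ENNReal.rpow_neg, ENNReal.rpow_neg]
        gcongr

theorem iSup_rpow_le_sum_rpow {κ : Type*} [Fintype κ] (F : κ → ℝ≥0∞) {q : ℝ} (hq : 0 < q) :
    (⨆ n, F n) ^ q ≤ ∑ n, F n ^ q := by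
  rw [← ENNReal.le_rpow_inv_iff hq]
  refine iSup_le fun n => (ENNReal.le_rpow_inv_iff hq).2 ?_
  exact Finset.single_le_sum (f := fun n => F n ^ q) (fun _ _ => zero_le) (Finset.mem_univ n)

theorem fracMaximal_le_mul_iSup_familyMaximal {α : ℝ} (hα : 0 ≤ 1 - α / d)
    (φ : (Fin d → ℝ) → ℝ) (x : Fin d → ℝ) :
    fracMaximal α φ x ≤ (6 ^ d) ^ (1 - α / d) *
      ⨆ n : Fin d → Fin 2,
        familyMaximal (triadicCube n) volume (1 - α / d) (fun u => ‖φ u‖ₑ) x := by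
  refine iSup_le fun Q => iSup₂_le fun hQ hx => ?_
  obtain ⟨n, a, hQa, hvol⟩ := hQ.exists_subset_triadicCube
  set T := triadicCube n a
  calc volume Q ^ (α / d - 1) * ∫⁻ u in Q, ‖φ u‖ₑ
      = volume Q ^ (-(1 - α / d)) * ∫⁻ u in Q, ‖φ u‖ₑ := by rw [neg_sub]
    _ ≤ (6 ^ d) ^ (1 - α / d) * volume T ^ (-(1 - α / d)) * ∫⁻ u in T, ‖φ u‖ₑ := by
        gcongr
        exact rpow_neg_le_mul_rpow_neg (by positivity) (by finiteness) hα hvol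
    _ ≤ _ := by
        rw [mul_assoc]
        gcongr
        exact (le_familyMaximal (P := triadicCube n) (hQa hx)).trans
          (le_iSup (fun n : Fin d → Fin 2 =>
            familyMaximal (triadicCube n) volume (1 - α / d) (fun u => ‖φ u‖ₑ) x) n)

theorem fracMaximal_rpow_le_mul_sum {α q r : ℝ} (hq : 0 < q) (hr : 0 ≤ r)
    (hα : 1 - α / d = r / q) (φ : (Fin d → ℝ) → ℝ) (x : Fin d → ℝ) :
    fracMaximal α φ x ^ q ≤ (6 ^ d) ^ r * ∑ n : Fin d → Fin 2,
      familyMaximal (triadicCube n) volume (r / q) (fun u => ‖φ u‖ₑ) x ^ q := by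
  have hle := fracMaximal_le_mul_iSup_familyMaximal (hα ▸ div_nonneg hr hq.le) φ x
  rw [hα] at hle
  refine (ENNReal.rpow_le_rpow hle hq.le).trans ?_
  rw [ENNReal.mul_rpow_of_nonneg _ _ hq.le, ← ENNReal.rpow_mul, div_mul_cancel₀ _ hq.ne']
  gcongr
  exact iSup_rpow_le_sum_rpow _ hq

theorem familyApChar_triadicCube_le (n : Fin d → Fin 2) {w : (Fin d → ℝ) → ℝ} (r : ℝ) :
    familyApChar (triadicCube n) volume (volume.withDensity fun x => ENNReal.ofReal (w x))
      (volume.withDensity fun x => ENNReal.ofReal (w x) ^ (-1 / (r - 1))) r ≤ ApChar r w := by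
  refine iSup_le fun a => ?_
  obtain ⟨Q, hQ, hae⟩ := exists_isCube_ae_eq_triadicCube n a
  rw [withDensity_apply _ (measurableSet_triadicCube n a),
    withDensity_apply _ (measurableSet_triadicCube n a), setLIntegral_congr hae,
    setLIntegral_congr hae, measure_congr hae]
  exact le_iSup₂ (f := fun Q (_ : IsCube Q) =>
    ((volume Q)⁻¹ * ∫⁻ x in Q, ENNReal.ofReal (w x)) *
      ((volume Q)⁻¹ * ∫⁻ x in Q, ENNReal.ofReal (w x) ^ (-1 / (r - 1))) ^ (r - 1)) Q hQ

/-- The `q`-th power of the norm of the fractional maximal operator in dimension `d`, as a map from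
`L^p(w^(p/q))` to `L^q(w)`, is at most this constant times `[w]_{A_r} ^ r'`. -/
noncomputable def fracMaximalConst (d : ℕ) (p r r' : ℝ) : ℝ≥0∞ :=
  (6 ^ d) ^ r * (2 ^ d * (maximalConst r' * maximalConst p))

theorem fracMaximalConst_ne_top {p r r' : ℝ} (hp : 1 ≤ p) (hr : 0 ≤ r) (hr' : 1 ≤ r') :
    fracMaximalConst d p r r' ≠ ∞ := by
  have h6 : ((6 : ℝ≥0∞) ^ d) ^ r ≠ ∞ := ENNReal.rpow_ne_top_of_nonneg hr (by finiteness)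
  have hmp := maximalConst_ne_top hp
  have hmr' := maximalConst_ne_top hr'
  unfold fracMaximalConst
  finiteness

variable {p p' q r r' α : ℝ} {w φ : (Fin d → ℝ) → ℝ}

theorem lintegral_fracMaximal_rpow_le (hp : p.HolderConjugate p') (hr : r.HolderConjugate r')
    (hpq : p ≤ q) (hrq : r = q / p' + 1) (hα : 1 - α / d = r / q) (hw : IsApWeight r w)
    (hφ : AEMeasurable φ) :
    ∫⁻ x, fracMaximal α φ x ^ q ∂(volume.withDensity fun x => ENNReal.ofReal (w x)) ≤
      fracMaximalConst d p r r' * ApChar r w ^ r' *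
        (∫⁻ x, ‖φ x‖ₑ ^ p * ENNReal.ofReal (w x) ^ (p / q)) ^ (q / p) := by
  have hq : 0 < q := hp.pos.trans_le hpq
  have hdual : -1 / (r - 1) = 1 - r' := by
    rw [hr.conjugate_eq]
    field_simp [hr.sub_one_ne_zero]
    ring
  set W : (Fin d → ℝ) → ℝ≥0∞ := fun x => ENNReal.ofReal (w x)
  have hW : AEMeasurable W := hw.1.1.aestronglyMeasurable.aemeasurable.ennreal_ofReal
  have hW0 : ∀ᵐ x, W x ≠ 0 := hw.1.2.mono fun x hx => (ENNReal.ofReal_pos.2 hx).ne'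
  set F := fun n : Fin d → Fin 2 =>
    familyMaximal (triadicCube n) volume (r / q) fun u => ‖φ u‖ₑ
  have hF (n) : Measurable fun x => F n x ^ q :=
    (measurable_familyMaximal (measurableSet_triadicCube n)).pow_const q
  set N := ∫⁻ x, ‖φ x‖ₑ ^ p * W x ^ (p / q)
  calc ∫⁻ x, fracMaximal α φ x ^ q ∂(volume.withDensity W)
      ≤ ∫⁻ x, (6 ^ d) ^ r * ∑ n, F n x ^ q ∂(volume.withDensity W) :=
        lintegral_mono fun x => fracMaximal_rpow_le_mul_sum hq hr.nonneg hα φ x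
    _ = (6 ^ d) ^ r * ∑ n, ∫⁻ x, F n x ^ q ∂(volume.withDensity W) := by
        rw [lintegral_const_mul _ (Finset.measurable_fun_sum _ fun n _ => hF n),
          lintegral_finsetSum _ fun n _ => hF n]
    _ ≤ (6 ^ d) ^ r * ∑ _n : Fin d → Fin 2,
          ApChar r w ^ r' * (maximalConst r' * (maximalConst p * N ^ (q / p))) := by
        gcongr with n
        refine (isNestedFamily_triadicCube n).lintegral_familyMaximal_rpow_withDensity_le
          (measurableSet_triadicCube n) hp hr hpq hrq hW hW0 (.of_forall fun _ => by finiteness)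
          hφ.enorm hw.2.ne ?_
        exact hdual ▸ familyApChar_triadicCube_le n r
    _ = fracMaximalConst d p r r' * ApChar r w ^ r' * N ^ (q / p) := by
        rw [Finset.sum_const, nsmul_eq_mul, fracMaximalConst]
        simp only [Finset.card_univ, Fintype.card_pi, Fintype.card_fin, Finset.prod_const,
          Nat.cast_pow, Nat.cast_ofNat]
        ring

end FracMaximal

section WeightedNorm

variable {d : ℕ} {p q : ℝ} {w : (Fin d → ℝ) → ℝ}

theorem weightedNorm_eq_lintegral_withDensity_rpow (hw : AEMeasurable w)
    (f : (Fin d → ℝ) → ℝ≥0∞) :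
    weightedNorm q w f =
      (∫⁻ x, f x ^ q ∂(volume.withDensity fun x => ENNReal.ofReal (w x))) ^ (1 / q) := by
  rw [lintegral_withDensity_eq_lintegral_mul_non_measurable₀ _ hw.ennreal_ofReal
    (.of_forall fun _ => ENNReal.ofReal_lt_top)]
  simp only [weightedNorm, Pi.mul_apply, mul_comm]

theorem weightedNorm_rpow_weight_eq (hw : ∀ᵐ x, 0 < w x) (s : ℝ) (f : (Fin d → ℝ) → ℝ≥0∞) :
    weightedNorm p (fun x => w x ^ s) f =
      (∫⁻ x, f x ^ p * ENNReal.ofReal (w x) ^ s) ^ (1 / p) := by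
  refine congrArg (· ^ (1 / p)) (lintegral_congr_ae ?_)
  filter_upwards [hw] with x hx
  rw [ENNReal.ofReal_rpow_of_pos hx]

theorem weightedNorm_fracMaximal_le {p' r r' α : ℝ} {φ : (Fin d → ℝ) → ℝ}
    (hp : p.HolderConjugate p') (hr : r.HolderConjugate r') (hpq : p ≤ q)
    (hrq : r = q / p' + 1) (hα : 1 - α / d = r / q) (hw : IsApWeight r w)
    (hφ : AEMeasurable φ) :
    weightedNorm q w (fracMaximal α φ) ≤
      fracMaximalConst d p r r' ^ (1 / q) * ApChar r w ^ (r' / q) *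
        weightedNorm p (fun x => w x ^ (p / q)) fun x => ‖φ x‖ₑ := by
  have hp0 : 0 < p := hp.pos
  have hq : 0 < q := hp0.trans_le hpq
  rw [weightedNorm_eq_lintegral_withDensity_rpow hw.1.1.aestronglyMeasurable.aemeasurable,
    weightedNorm_rpow_weight_eq hw.1.2]
  refine (ENNReal.rpow_le_rpow (lintegral_fracMaximal_rpow_le hp hr hpq hrq hα hw hφ)
    (by positivity)).trans_eq ?_
  rw [ENNReal.mul_rpow_of_nonneg _ _ (by positivity),
    ENNReal.mul_rpow_of_nonneg _ _ (by positivity), ← ENNReal.rpow_mul, ← ENNReal.rpow_mul,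
    mul_one_div, div_mul_div_cancel₀' hq.ne', mul_comm]

end WeightedNorm

theorem mainTheorem3_general {d : ℕ} {p α q : ℝ} (hp : 1 < p) (hα : 0 ≤ α) (hαd : α < d)
    (hq : 0 < q) (hpq : 1 / q = 1 / p - α / d) :
    ∃ C : ℝ≥0, 0 < C ∧ ∀ w φ : (Fin d → ℝ) → ℝ,
      IsApWeight (q / Real.conjExponent p + 1) w → AEMeasurable φ →
        weightedNorm q w (fracMaximal α φ) ≤
          C * ApChar (q / Real.conjExponent p + 1) w ^ ((1 - α / d) * Real.conjExponent p / q) *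
            weightedNorm p (fun x => w x ^ (p / q)) (fun x => ‖φ x‖ₑ) := by
  have hp' := Real.HolderConjugate.conjExponent hp
  set p' := Real.conjExponent p
  set r := q / p' + 1 with hrq
  have hr' := Real.HolderConjugate.conjExponent
    (show 1 < r from lt_add_of_pos_left 1 (div_pos hq hp'.symm.pos))
  set r' := Real.conjExponent r
  have hle : p ≤ q := (one_div_le_one_div hq hp'.pos).1 <| by
    rw [hpq]
    exact sub_le_self _ (div_nonneg hα (hα.trans hαd.le))
  have hαr : 1 - α / d = r / q := by
    rw [muckenhoupt_exponent_div_eq hp' hq.ne' hrq, hpq]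
    ring
  have hexp : (1 - α / d) * p' / q = r' / q := by
    have hr1' : r - 1 = q / p' := by rw [hrq, add_sub_cancel_right]
    rw [hαr, hr'.conjugate_eq, hr1']
    field_simp
  have hC : fracMaximalConst d p r r' ^ (1 / q) ≠ ∞ :=
    ENNReal.rpow_ne_top_of_nonneg (by positivity)
      (fracMaximalConst_ne_top hp.le hr'.nonneg hr'.symm.lt.le)
  refine ⟨(fracMaximalConst d p r r' ^ (1 / q)).toNNReal + 1, by positivity, fun w φ hw hφ => ?_⟩
  rw [hexp]
  refine (weightedNorm_fracMaximal_le hp' hr' hle hrq hαr hw hφ).trans ?_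
  gcongr
  rw [ENNReal.coe_add, ENNReal.coe_toNNReal hC]
  exact le_self_add

theorem exists_weightedNorm_fracMaximal_zero_le {d : ℕ} (hd : 0 < d) {p : ℝ} (hp : 1 < p) :
    ∃ C : ℝ≥0, 0 < C ∧ ∀ w φ : (Fin d → ℝ) → ℝ, IsApWeight p w → AEMeasurable φ →
      weightedNorm p w (fracMaximal 0 φ) ≤
        C * ApChar p w ^ (1 / (p - 1)) * weightedNorm p w (fun x => ‖φ x‖ₑ) := by
  have hp0 : 0 < p := one_pos.trans hp
  have hp1 : p - 1 ≠ 0 := (sub_pos.2 hp).ne'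
  have hr : p / Real.conjExponent p + 1 = p := by
    rw [Real.conjExponent]
    field_simp
    ring
  have hexp : (1 - 0 / (d : ℝ)) * Real.conjExponent p / p = 1 / (p - 1) := by
    rw [Real.conjExponent, zero_div, sub_zero, one_mul]
    field_simp
  have h := mainTheorem3_general hp le_rfl (Nat.cast_pos.2 hd) hp0 (by simp)
  simpa only [hr, hexp, div_self hp0.ne', Real.rpow_one] using h

theorem mainTheorem3 (d : ℕ) (hd : 1 ≤ d) (p : ℝ) (hp : 1 < p) :
    (∀ α q : ℝ, 0 ≤ α → α < d → 0 < q → 1 / q = 1 / p - α / d →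
      ∃ C : ℝ≥0, 0 < C ∧
        ∀ w φ : (Fin d → ℝ) → ℝ,
          IsApWeight (q / Real.conjExponent p + 1) w → LocallyIntegrable φ volume →
            weightedNorm q w (fracMaximal α φ) ≤
              C * ApChar (q / Real.conjExponent p + 1) w ^
                    ((1 - α / d) * Real.conjExponent p / q) *
                weightedNorm p (fun x => w x ^ (p / q)) (fun x => ‖φ x‖ₑ)) ∧
    (∃ C : ℝ≥0, 0 < C ∧
      ∀ w φ : (Fin d → ℝ) → ℝ,
        IsApWeight p w → LocallyIntegrable φ volume →
          weightedNorm p w (fracMaximal 0 φ) ≤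
            C * ApChar p w ^ (1 / (p - 1)) * weightedNorm p w (fun x => ‖φ x‖ₑ)) := by
  constructor
  · intro α q hα hαd hq hpq
    obtain ⟨C, hC, h⟩ := mainTheorem3_general hp hα hαd hq hpq
    exact ⟨C, hC, fun w φ hw hφ => h w φ hw hφ.aestronglyMeasurable.aemeasurable⟩
  · obtain ⟨C, hC, h⟩ := exists_weightedNorm_fracMaximal_zero_le hd hp
    exact ⟨C, hC, fun w φ hw hφ => h w φ hw hφ.aestronglyMeasurable.aemeasurable⟩
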